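/- Let $B$ be a unital $\mathrm{C}^*$-algebra and let $M\subset B$ be a linear subspace containing the unit of $B$ such that $B=\mathrm{C}^*(M)$, i.e. $B$ is the $\mathrm{C}^*$-algebra generated by $M$. Let $\omega$ be a state on $B$ which is $M$-detectable: there is a bounded net $(a_\lambda)$ in $M$ such that $\omega(a_\lambda^*a_\lambda)=1$ for every $\lambda$, while for every state $\psi$ on $B$ distinct from $\omega$ there is an index $\mu$ such that $\psi(a_\lambda^*a_\lambda)<1$ whenever $\lambda\geq\mu$. Then the GNS representation $\sigma:B\to B(H)$ of $\omega$ is a boundary representation for $M$: it is irreducible, and every unital completely positive map $\psi:B\to B(H)$ that agrees with $\sigma$ on $M$ agrees with $\sigma$ on all of $B$. -/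

import Mathlib

open scoped CStarAlgebra ComplexOrder

universe u v

/-- A state on a unital C⋆-algebra: a positive linear functional taking the value `1` at the
unit. -/
def IsCStarState {B : Type*} [CStarAlgebra B] [PartialOrder B] [StarOrderedRing B]
    (ω : B →ₚ[ℂ] ℂ) : Prop :=
  ω 1 = 1

/-- The state `ω` is `M`-detectable: some bounded net `(a i)` in `M`, indexed by a non-empty
directed set, satisfies `ω (a i⋆ a i) = 1` for all `i`, while for every state `ψ ≠ ω` one
eventually has `ψ (a i⋆ a i) < 1`. (The numbers `ψ (a i⋆ a i)` are real and nonnegative.) -/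
def IsDetectableState {B : Type u} [CStarAlgebra B] [PartialOrder B] [StarOrderedRing B]
    (M : Submodule ℂ B) (ω : B →ₚ[ℂ] ℂ) : Prop :=
  IsCStarState ω ∧
    ∃ (ι : Type v) (_ : Preorder ι) (_ : IsDirectedOrder ι) (_ : Nonempty ι) (a : ι → B),
      (∀ i, a i ∈ M) ∧
      (∃ C : ℝ, ∀ i, ‖a i‖ ≤ C) ∧
      (∀ i, ω (star (a i) * a i) = 1) ∧
      ∀ ψ : B →ₚ[ℂ] ℂ, IsCStarState ψ → ψ ≠ ω →
        ∃ j, ∀ i, j ≤ i → (ψ (star (a i) * a i)).re < 1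

/-- The unital `⋆`-representation `π` of `B` on the Hilbert space `H` has the unique extension
property with respect to `M`: every unital completely positive map `B → B(H)` agreeing with `π`
on `M` agrees with `π` on `B`. -/
def HasUniqueExtensionProperty {B H : Type*} [CStarAlgebra B] [PartialOrder B]
    [StarOrderedRing B] [NormedAddCommGroup H] [InnerProductSpace ℂ H] [CompleteSpace H]
    (M : Submodule ℂ B) (π : B →⋆ₐ[ℂ] (H →L[ℂ] H)) : Prop :=
  ∀ ψ : B →CP (H →L[ℂ] H), ψ 1 = 1 → (∀ a ∈ M, ψ a = π a) → ∀ b : B, ψ b = π b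

/-- The representation `π` on `H` is (topologically) irreducible: `H` is nonzero and the only
closed subspaces invariant under `π B` are `0` and `H`. -/
def IsIrreducibleRepresentation {B H : Type*} [CStarAlgebra B]
    [NormedAddCommGroup H] [InnerProductSpace ℂ H] [CompleteSpace H]
    (π : B →⋆ₐ[ℂ] (H →L[ℂ] H)) : Prop :=
  Nontrivial H ∧
    ∀ K : Submodule ℂ H, IsClosed (K : Set H) → (∀ b : B, ∀ x ∈ K, π b x ∈ K) →
      K = ⊥ ∨ K = ⊤

/-- A boundary representation for `M` (where `M` generates `B` as a C⋆-algebra): an irreducible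
unital `⋆`-representation with the unique extension property with respect to `M`. -/
def IsBoundaryRepresentation {B H : Type*} [CStarAlgebra B] [PartialOrder B]
    [StarOrderedRing B] [NormedAddCommGroup H] [InnerProductSpace ℂ H] [CompleteSpace H]
    (M : Submodule ℂ B) (π : B →⋆ₐ[ℂ] (H →L[ℂ] H)) : Prop :=
  HasUniqueExtensionProperty M π ∧ IsIrreducibleRepresentation π

/-!
Let `π` be the GNS representation of the detectable state `ω`, with cyclic unit vector `ξ`, so
that `ω b = ⟪ξ, π b ξ⟫`.

*Irreducibility.* A nontrivial reducing subspace splits `ξ = x + y` and exhibits `ω` as a proper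
convex combination of the normalised vector states of `x` and `y`. Since `ω (a i⋆ a i) = 1`,
detectability forbids both of them from differing from `ω`; if that of `x`, say, is `ω`, then
cyclicity gives `x = ‖x‖² ξ` and hence `y = 0` (`eq_zero_of_inner_normalize_eq`).

*Unique extension.* Let `ψ` be unital completely positive and equal to `π` on `M`. By the
Kadison–Schwarz inequality the state `b ↦ ⟪ξ, ψ b ξ⟫` is at least `1` on every `a i⋆ a i`, so it
is `ω`. Consequently, whenever `ψ b ξ = π b ξ`, the Kadison–Schwarz inequality for `b` is an
equality at `ξ`, which forces `ψ (c b) ξ = ψ c (ψ b ξ)` for every `c`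
(`CompletelyPositiveMap.map_mul_apply_of_inner_eq`). The closed subspace of such `b` therefore
contains `1` and is stable under left multiplication by `M` and `M⋆`, so it is `B`; then
`ψ c (π b ξ) = ψ (c b) ξ = π c (π b ξ)` for all `b` and `c`, and `ψ = π` because `ξ` is cyclic
(`completelyPositive_eq_of_inner_eq`).

The Kadison–Schwarz inequality and its equality case are read off from the positivity of the form
`⟪b ⊗ x, c ⊗ y⟫ = ⟪x, ψ (b⋆ c) y⟫` on `B ⊗ H`; no dilation is constructed.
-/

open scoped InnerProductSpace

/-! ### Vector functionals -/

section VectorFunctional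

variable {B H : Type*} [CStarAlgebra B] [NormedAddCommGroup H] [InnerProductSpace ℂ H]

lemma inner_self_eq_ofReal_norm_sq (x : H) : ⟪x, x⟫_ℂ = (‖x‖ : ℂ) ^ 2 :=
  inner_self_eq_norm_sq_to_K x

lemma inner_map_star_mul_self [CompleteSpace H] (π : B →⋆ₐ[ℂ] (H →L[ℂ] H)) (a : B) (x : H) :
    ⟪x, π (star a * a) x⟫_ℂ = (‖π a x‖ : ℂ) ^ 2 := by
  rw [map_mul, map_star, ContinuousLinearMap.star_eq_adjoint, mul_apply_eq_comp,
    ContinuousLinearMap.adjoint_inner_right, inner_self_eq_ofReal_norm_sq]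

variable [PartialOrder B] [StarOrderedRing B]

/-- The positive functional `b ↦ ⟪x, f b x⟫` attached to a positive map `f : B → B(H)` and a
vector `x` of `H`. -/
noncomputable def vectorFunctional (f : B →ₚ[ℂ] (H →L[ℂ] H)) (x : H) : B →ₚ[ℂ] ℂ :=
  PositiveLinearMap.mk₀
    ((innerSL ℂ x).toLinearMap ∘ₗ (ContinuousLinearMap.apply ℂ H x).toLinearMap ∘ₗ f.toLinearMap)
    fun b hb => by
      have h : 0 ≤ f b := f.map_nonneg hb
      rw [ContinuousLinearMap.nonneg_iff_isPositive] at h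
      exact h.inner_nonneg_right x

lemma vectorFunctional_apply (f : B →ₚ[ℂ] (H →L[ℂ] H)) (x : H) (b : B) :
    vectorFunctional f x b = ⟪x, f b x⟫_ℂ := rfl

lemma isCStarState_vectorFunctional {f : B →ₚ[ℂ] (H →L[ℂ] H)} (hf : f 1 = 1) {x : H}
    (hx : ‖x‖ = 1) : IsCStarState (vectorFunctional f x) := by
  simp [IsCStarState, vectorFunctional_apply, hf, hx]

end VectorFunctional

/-! ### The Kadison–Schwarz inequality and its equality case -/

section CompletelyPositive

variable {B H : Type*} [CStarAlgebra B] [PartialOrder B] [StarOrderedRing B]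
  [NormedAddCommGroup H] [InnerProductSpace ℂ H] [CompleteSpace H]

lemma CStarMatrix.sum_inner_nonneg {n : Type*} [Fintype n]
    {P : CStarMatrix n n (H →L[ℂ] H)} (hP : 0 ≤ P) (x : n → H) :
    0 ≤ ∑ i, ∑ j, ⟪x i, P i j (x j)⟫_ℂ := by
  rw [StarOrderedRing.nonneg_iff] at hP
  induction hP using AddSubmonoid.closure_induction with
  | mem P hP =>
    obtain ⟨Y, rfl⟩ := hP
    have key : ∑ i, ∑ j, ⟪x i, (star Y * Y) i j (x j)⟫_ℂ
        = ∑ k, ⟪∑ i, Y k i (x i), ∑ j, Y k j (x j)⟫_ℂ := by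
      simp only [CStarMatrix.mul_apply, CStarMatrix.star_apply, sum_apply,
        mul_apply_eq_comp, ContinuousLinearMap.star_eq_adjoint, inner_sum, sum_inner,
        ContinuousLinearMap.adjoint_inner_right]
      rw [Finset.sum_comm]
      conv_rhs => rw [Finset.sum_comm]
      exact Finset.sum_congr rfl fun j _ => Finset.sum_comm
    rw [key]
    exact Finset.sum_nonneg fun k _ => by
      rw [inner_self_eq_ofReal_norm_sq]; exact_mod_cast sq_nonneg (‖_‖ : ℝ)
  | zero => simp [CStarMatrix.zero_apply]
  | add P Q _ _ hP hQ =>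
    simp only [CStarMatrix.add_apply, _root_.add_apply, inner_add_right, Finset.sum_add_distrib]
    exact add_nonneg hP hQ

/-- Positivity of the sesquilinear form `⟪b ⊗ x, c ⊗ y⟫ = ⟪x, ψ (b⋆ c) y⟫` on which the
Stinespring dilation of `ψ` is built. -/
lemma CompletelyPositiveMap.sum_inner_nonneg (ψ : B →CP (H →L[ℂ] H)) {n : ℕ} [NeZero n]
    (b : Fin n → B) (x : Fin n → H) :
    0 ≤ ∑ i, ∑ j, ⟪x i, ψ (star (b i) * b j) (x j)⟫_ℂ := by
  let Y : CStarMatrix (Fin n) (Fin n) B :=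
    CStarMatrix.ofMatrix fun i j => if i = 0 then b j else 0
  have hY₀ : ∀ i j, Y i j = if i = 0 then b j else 0 := fun _ _ => rfl
  have hY : ∀ i j, (star Y * Y) i j = star (b i) * b j := fun i j => by
    simp [hY₀, CStarMatrix.mul_apply, CStarMatrix.star_apply]
  have h := CStarMatrix.sum_inner_nonneg
    (ψ.map_cstarMatrix_nonneg (star Y * Y) (star_mul_self_nonneg Y)) x
  simpa only [CStarMatrix.map_apply, hY] using h

variable {ψ : B →CP (H →L[ℂ] H)}

lemma CompletelyPositiveMap.inner_map_star_left (b : B) (x y : H) :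
    ⟪x, ψ (star b) y⟫_ℂ = ⟪ψ b x, y⟫_ℂ := by
  rw [map_star, ContinuousLinearMap.star_eq_adjoint, ContinuousLinearMap.adjoint_inner_right]

/-- The Kadison–Schwarz inequality `ψ b⋆ ψ b ≤ ψ (b⋆ b)`, tested on a vector. -/
lemma CompletelyPositiveMap.norm_sq_le_inner (hψ : ψ 1 = 1) (b : B) (x : H) :
    ((‖ψ b x‖ : ℂ)) ^ 2 ≤ ⟪x, ψ (star b * b) x⟫_ℂ := by
  have h := ψ.sum_inner_nonneg ![b, 1] ![x, -ψ b x]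
  simp only [Fin.sum_univ_two, Matrix.cons_val_zero, Matrix.cons_val_one, mul_one, star_one,
    one_mul, inner_map_star_left, hψ, one_apply_eq_self, inner_neg_left,
    inner_neg_right, map_neg, inner_self_eq_ofReal_norm_sq] at h
  rw [← sub_nonneg]
  convert h using 1
  ring

/-- If the Kadison–Schwarz inequality for `b` is an equality at the vector `x`, then `b` behaves
at `x` as an element of the multiplicative domain of `ψ`. -/
lemma CompletelyPositiveMap.map_mul_apply_of_inner_eq (hψ : ψ 1 = 1) {b : B} {x : H}
    (h : ⟪x, ψ (star b * b) x⟫_ℂ = (‖ψ b x‖ : ℂ) ^ 2) (c : B) :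
    ψ (c * b) x = ψ c (ψ b x) := by
  set y := ψ (c * b) x - ψ c (ψ b x) with hy
  set q := (⟪y, ψ (c * star c) y⟫_ℂ).re
  -- `b ⊗ x - 1 ⊗ ψ b x` is null for the form, hence orthogonal to `c⋆ ⊗ y`.
  have key : ∀ t : ℝ, 0 ≤ t ^ 2 * q - 2 * t * ‖y‖ ^ 2 := by
    intro t
    have hpos := ψ.sum_inner_nonneg ![b, 1, star c] ![x, -ψ b x, -(t : ℂ) • y]
    have h1 : ⟪y, ψ (c * b) x⟫_ℂ - ⟪y, ψ c (ψ b x)⟫_ℂ = (‖y‖ : ℂ) ^ 2 := by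
      rw [← inner_sub_right, ← hy, inner_self_eq_ofReal_norm_sq]
    have h2 : ⟪ψ (c * b) x, y⟫_ℂ - ⟪ψ c (ψ b x), y⟫_ℂ = (‖y‖ : ℂ) ^ 2 := by
      rw [← inner_sub_left, ← hy, inner_self_eq_ofReal_norm_sq]
    have h3 : ⟪ψ (star c) y, ψ b x⟫_ℂ = ⟪y, ψ c (ψ b x)⟫_ℂ := by
      rw [← inner_map_star_left, star_star]
    have e1 : star b * star c = star (c * b) := by simp
    simp only [Fin.sum_univ_three, Matrix.cons_val_zero, Matrix.cons_val_one, Matrix.cons_val,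
      mul_one, star_one, one_mul, star_star, e1, inner_map_star_left, hψ,
      one_apply_eq_self, inner_neg_left, inner_neg_right, map_neg, neg_smul,
      map_smul, inner_smul_left, inner_smul_right, Complex.conj_ofReal, h,
      inner_self_eq_ofReal_norm_sq] at hpos
    have e2 : (0 : ℂ) ≤ (t : ℂ) ^ 2 * ⟪y, ψ (c * star c) y⟫_ℂ - 2 * t * (‖y‖ : ℂ) ^ 2 := by
      refine hpos.trans_eq ?_
      linear_combination (-t : ℂ) * h1 - (t : ℂ) * h2 + (t : ℂ) * h3
    have e3 := (Complex.nonneg_iff.mp e2).1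
    simpa [← Complex.ofReal_pow, ← Complex.ofReal_mul, Complex.re_ofReal_mul] using e3
  have hy0 : ‖y‖ ^ 2 = 0 := by
    have hq : 0 < |q| + 1 := by positivity
    have := key (‖y‖ ^ 2 / (|q| + 1))
    have h3 : (‖y‖ ^ 2 / (|q| + 1)) * (|q| + 1) = ‖y‖ ^ 2 := by field_simp
    set s := ‖y‖ ^ 2 / (|q| + 1)
    rw [← h3] at this
    have hs : s ^ 2 ≤ 0 := by
      have h4 : s ^ 2 * q ≤ s ^ 2 * |q| := by gcongr; exact le_abs_self q
      have h5 : 0 ≤ s ^ 2 * |q| := by positivity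
      linarith
    rw [← h3, sq_eq_zero_iff.mp (hs.antisymm (sq_nonneg s)), zero_mul]
  exact sub_eq_zero.mp (by simpa using hy0)

end CompletelyPositive

/-! ### Representations with a cyclic vector -/

section CyclicVector

variable {B H : Type*} [CStarAlgebra B]
  [NormedAddCommGroup H] [InnerProductSpace ℂ H] [CompleteSpace H]
  {π : B →⋆ₐ[ℂ] (H →L[ℂ] H)} {ξ : H}

/-- A splitting `ξ = x + y` along two orthogonal invariant subspaces is trivial as soon as the
normalised vector state of `x` is that of `ξ`. -/
lemma eq_zero_of_inner_normalize_eq (hξ : DenseRange fun b => π b ξ)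
    {x y : H} (hxy : x + y = ξ) (hx : x ≠ 0) (horth : ∀ b, ⟪x, π b y⟫_ℂ = 0)
    (h : ∀ b, ⟪(‖x‖⁻¹ : ℂ) • x, π b ((‖x‖⁻¹ : ℂ) • x)⟫_ℂ = ⟪ξ, π b ξ⟫_ℂ) : y = 0 := by
  have hx0 : (‖x‖ : ℂ) ≠ 0 := by simpa using hx
  have h1 : x = (‖x‖ ^ 2 : ℂ) • ξ := by
    refine hξ.eq_of_inner_left (𝕜 := ℂ) ?_
    intro b
    have hb := h b
    have hxb : ⟪x, π b ξ⟫_ℂ = ⟪x, π b x⟫_ℂ := by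
      rw [← hxy, map_add, inner_add_right, horth, add_zero]
    simp only [map_smul, inner_smul_left, inner_smul_right, map_inv₀, Complex.conj_ofReal,
      map_pow] at hb ⊢
    rw [← hb, hxb]
    field_simp
  have h2 : ⟪x, y⟫_ℂ = 0 := by simpa using horth 1
  have h3 : ⟪ξ, y⟫_ℂ = 0 := by
    rw [h1, inner_smul_left] at h2
    simpa [hx0] using h2
  rw [← hxy, inner_add_left, h2, zero_add] at h3
  exact inner_self_eq_zero.mp h3

variable [PartialOrder B] [StarOrderedRing B] {ω : B →ₚ[ℂ] ℂ}

/-- If a unital completely positive `ψ` agrees with `π` on a generating subspace `M` and has the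
same vector functional at the cyclic vector `ξ`, then `ψ = π`. Equality of the functionals turns
`ψ b ξ = π b ξ` into an equality in the Kadison–Schwarz inequality, so that the set of such `b` is
stable under left multiplication by `M` and `M⋆`; it contains `1` and is closed, hence is all
of `B`. -/
lemma completelyPositive_eq_of_inner_eq {M : Submodule ℂ B}
    (hM_gen : (StarAlgebra.adjoin ℂ (M : Set B)).topologicalClosure = ⊤)
    (hξ : DenseRange fun b => π b ξ) {ψ : B →CP (H →L[ℂ] H)} (hψ : ψ 1 = 1)
    (hM : ∀ a ∈ M, ψ a = π a) (hω : ∀ b, ⟪ξ, ψ b ξ⟫_ℂ = ⟪ξ, π b ξ⟫_ℂ) (b : B) :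
    ψ b = π b := by
  have hmul : ∀ b, ψ b ξ = π b ξ → ∀ c, ψ (c * b) ξ = ψ c (π b ξ) := fun b hb c => by
    rw [← hb]
    refine CompletelyPositiveMap.map_mul_apply_of_inner_eq hψ ?_ c
    rw [hω, inner_map_star_mul_self, hb]
  have hM' : ∀ a ∈ M, ψ (star a) = π (star a) := fun a ha => by
    rw [map_star, map_star, hM a ha]
  -- Stability of `{b | ψ b ξ = π b ξ}` under left multiplication by `a` and by `a⋆` is proved
  -- jointly, since only the pair passes from `a` to `a⋆`.
  have hadj : ∀ a ∈ StarAlgebra.adjoin ℂ (M : Set B),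
      (∀ b, ψ b ξ = π b ξ → ψ (a * b) ξ = π (a * b) ξ) ∧
      (∀ b, ψ b ξ = π b ξ → ψ (star a * b) ξ = π (star a * b) ξ) := by
    intro a ha
    induction ha using StarAlgebra.adjoin_induction with
    | mem a ha =>
      exact ⟨fun b hb => by rw [hmul b hb, hM a ha, map_mul, mul_apply_eq_comp],
        fun b hb => by rw [hmul b hb, hM' a ha, map_mul, mul_apply_eq_comp]⟩
    | algebraMap r =>
      refine ⟨fun b hb => ?_, fun b hb => ?_⟩ <;>
        simp [Algebra.algebraMap_eq_smul_one, hb]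
    | add a a' _ _ h h' =>
      exact ⟨fun b hb => by simp [add_mul, h.1 b hb, h'.1 b hb, -map_mul],
        fun b hb => by simp [add_mul, h.2 b hb, h'.2 b hb, -map_mul]⟩
    | mul a a' _ _ h h' =>
      refine ⟨fun b hb => ?_, fun b hb => ?_⟩
      · rw [mul_assoc]; exact h.1 _ (h'.1 b hb)
      · rw [star_mul, mul_assoc]; exact h'.2 _ (h.2 b hb)
    | star a _ h => exact ⟨h.2, by simpa only [star_star] using h.1⟩
  have hψc : Continuous ψ := map_continuous (PositiveLinearMap.ofClass ψ)
  have hπc : Continuous π := map_continuous π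
  have hall : ∀ b, ψ b ξ = π b ξ := fun b => by
    have hcl : IsClosed {b | ψ b ξ = π b ξ} := isClosed_eq (by fun_prop) (by fun_prop)
    have hb : b ∈ closure (StarAlgebra.adjoin ℂ (M : Set B) : Set B) := by
      rw [← StarSubalgebra.topologicalClosure_coe, hM_gen]; trivial
    refine closure_minimal (fun a ha => ?_) hcl hb
    simpa using (hadj a ha).1 1 (by simp [hψ])
  refine ContinuousLinearMap.coeFn_injective <| hξ.equalizer (ψ b).continuous (π b).continuous ?_
  funext c
  simp only [Function.comp_apply]
  rw [← hmul c (hall c) b, hall, map_mul, mul_apply_eq_comp]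

lemma norm_eq_one_of_isCStarState (hωξ : ∀ b, ω b = ⟪ξ, π b ξ⟫_ℂ) (hω : IsCStarState ω) :
    ‖ξ‖ = 1 := by
  have h : ω 1 = 1 := hω
  rw [hωξ, map_one, one_apply_eq_self, inner_self_eq_ofReal_norm_sq] at h
  exact (pow_eq_one_iff_of_nonneg (norm_nonneg _) two_ne_zero).mp (by exact_mod_cast h)

/-- The vector functional of `ψ` at `ξ` is a state which the Kadison–Schwarz inequality forces to
be at least `1` on every `a i⋆ a i`, so detectability identifies it with `ω`. -/
lemma hasUniqueExtensionProperty_of_isDetectableState {M : Submodule ℂ B}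
    (hM_gen : (StarAlgebra.adjoin ℂ (M : Set B)).topologicalClosure = ⊤)
    (hξ : DenseRange fun b => π b ξ) (hωξ : ∀ b, ω b = ⟪ξ, π b ξ⟫_ℂ)
    (hω : IsDetectableState M ω) : HasUniqueExtensionProperty M π := by
  obtain ⟨hω1, ι, _, _, _, a, haM, -, ha, hdet⟩ := hω
  have hξ1 : ‖ξ‖ = 1 := norm_eq_one_of_isCStarState hωξ hω1
  intro ψ hψ hψM
  have heq : vectorFunctional (PositiveLinearMap.ofClass ψ) ξ = ω := by
    by_contra hne
    obtain ⟨j, hj⟩ := hdet _ (isCStarState_vectorFunctional hψ hξ1) hne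
    refine (hj j le_rfl).not_ge ?_
    have h := CompletelyPositiveMap.norm_sq_le_inner hψ (a j) ξ
    rw [hψM _ (haM j), ← inner_map_star_mul_self, ← hωξ, ha] at h
    exact (Complex.le_def.mp h).1
  refine completelyPositive_eq_of_inner_eq hM_gen hξ hψ hψM fun b => ?_
  rw [← hωξ, ← heq]
  rfl

/-- For a nontrivial reducing subspace `K`, the state `ω` is a proper convex combination of the
normalised vector states of the two components of `ξ`. These cannot both differ from `ω`, for then
`ω (a i⋆ a i) < 1` eventually. -/
lemma isIrreducibleRepresentation_of_isDetectableState {M : Submodule ℂ B}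
    (hξ : DenseRange fun b => π b ξ) (hωξ : ∀ b, ω b = ⟪ξ, π b ξ⟫_ℂ)
    (hω : IsDetectableState M ω) : IsIrreducibleRepresentation π := by
  obtain ⟨hω1, ι, _, _, _, a, -, -, ha, hdet⟩ := hω
  have hξ1 : ‖ξ‖ = 1 := norm_eq_one_of_isCStarState hωξ hω1
  refine ⟨⟨ξ, 0, by rintro rfl; simp at hξ1⟩, fun K hK hinv => ?_⟩
  have hinv' : ∀ b : B, ∀ y ∈ Kᗮ, π b y ∈ Kᗮ := fun b y hy => by
    rw [Submodule.mem_orthogonal]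
    intro u hu
    rw [← ContinuousLinearMap.adjoint_inner_left, ← ContinuousLinearMap.star_eq_adjoint,
      ← map_star]
    exact Submodule.inner_right_of_mem_orthogonal (hinv _ u hu) hy
  have htop : ∀ K' : Submodule ℂ H, IsClosed (K' : Set H) → (∀ b : B, ∀ x ∈ K', π b x ∈ K') →
      ξ ∈ K' → K' = ⊤ := fun K' hK' h hm => by
    refine SetLike.coe_injective <| (hK'.closure_eq.symm.trans ?_)
    exact (hξ.mono (by rintro _ ⟨b, rfl⟩; exact h b ξ hm)).closure_eq
  have : CompleteSpace K := hK.completeSpace_coe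
  obtain ⟨x, hx, y, hy, hxy⟩ := K.exists_add_mem_mem_orthogonal ξ
  by_cases hx0 : x = 0
  · left
    have := htop Kᗮ K.isClosed_orthogonal hinv' (by rw [hxy, hx0, zero_add]; exact hy)
    simpa using this
  right
  suffices hy0 : y = 0 from htop K hK hinv (by rw [hxy, hy0, add_zero]; exact hx)
  by_contra hy0
  have horth : ∀ b, ⟪x, π b y⟫_ℂ = 0 := fun b =>
    Submodule.inner_right_of_mem_orthogonal hx (hinv' b y hy)
  have horth' : ∀ b, ⟪y, π b x⟫_ℂ = 0 := fun b =>
    Submodule.inner_left_of_mem_orthogonal (hinv b x hx) hy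
  let f : B →ₚ[ℂ] (H →L[ℂ] H) := PositiveLinearMap.ofClass π
  have hf : ∀ b, f b = π b := fun _ => rfl
  -- Detectability for the normalised vector state of `v`, cleared of the factor `‖v‖²`.
  have hdet' : ∀ v : H, v ≠ 0 →
      (¬ ∀ b, ⟪(‖v‖⁻¹ : ℂ) • v, π b ((‖v‖⁻¹ : ℂ) • v)⟫_ℂ = ⟪ξ, π b ξ⟫_ℂ) →
      ∃ j, ∀ i, j ≤ i → ‖π (a i) v‖ ^ 2 < ‖v‖ ^ 2 := fun v hv hne => by
    have hv' : 0 < ‖v‖ := norm_pos_iff.mpr hv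
    obtain ⟨j, hj⟩ := hdet (vectorFunctional f ((‖v‖⁻¹ : ℂ) • v))
      (isCStarState_vectorFunctional (by rw [hf, map_one])
        (by rw [norm_smul]; simp [hv'.ne']))
      (fun h => hne fun b => by rw [← hωξ, ← h]; rfl)
    refine ⟨j, fun i hi => ?_⟩
    have h := hj i hi
    rw [vectorFunctional_apply, hf, inner_map_star_mul_self, map_smul, norm_smul,
      ← Complex.ofReal_pow, Complex.ofReal_re] at h
    simp only [norm_inv, Complex.norm_real, norm_norm] at h
    rw [inv_mul_eq_div, div_pow, div_lt_one (by positivity)] at h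
    exact h
  obtain ⟨j₁, hj₁⟩ := hdet' x hx0 fun h =>
    hy0 (eq_zero_of_inner_normalize_eq hξ hxy.symm hx0 horth h)
  obtain ⟨j₂, hj₂⟩ := hdet' y hy0 fun h =>
    hx0 (eq_zero_of_inner_normalize_eq hξ ((add_comm y x).trans hxy.symm) hy0 horth' h)
  obtain ⟨i, hi₁, hi₂⟩ := exists_ge_ge j₁ j₂
  have hpyth : ∀ u ∈ K, ∀ v ∈ Kᗮ, ‖u + v‖ ^ 2 = ‖u‖ ^ 2 + ‖v‖ ^ 2 := fun u hu v hv => by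
    simpa only [sq] using norm_add_sq_eq_norm_sq_add_norm_sq_of_inner_eq_zero u v
      (Submodule.inner_right_of_mem_orthogonal hu hv)
  have h1 : ‖π (a i) ξ‖ ^ 2 = 1 := by
    have := ha i
    rw [hωξ, inner_map_star_mul_self] at this
    exact_mod_cast this
  rw [hxy, map_add, hpyth _ (hinv _ x hx) _ (hinv' _ y hy)] at h1
  have h2 : ‖ξ‖ ^ 2 = 1 := by rw [hξ1, one_pow]
  rw [hxy, hpyth x hx y hy] at h2
  linarith [hj₁ i hi₁, hj₂ i hi₂]

end CyclicVector

/-! ### The GNS representation of a detectable state -/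

lemma PositiveLinearMap.gnsStarAlgHom_apply_toPreGNS_one {B : Type*} [CStarAlgebra B]
    [PartialOrder B] [StarOrderedRing B] (ω : B →ₚ[ℂ] ℂ) (b : B) :
    ω.gnsStarAlgHom b (ω.toPreGNS 1 : ω.GNS) = (ω.toPreGNS b : ω.GNS) := by
  simp [PositiveLinearMap.gnsStarAlgHom_apply]

theorem theoremT {B : Type u} [CStarAlgebra B] [PartialOrder B] [StarOrderedRing B]
    (M : Submodule ℂ B) (hM_one : (1 : B) ∈ M)
    (hM_gen : (StarAlgebra.adjoin ℂ (M : Set B)).topologicalClosure = ⊤)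
    (ω : B →ₚ[ℂ] ℂ) (hω : IsDetectableState.{u, v} M ω) :
    IsBoundaryRepresentation M ω.gnsStarAlgHom := by
  have hξ : DenseRange fun b => ω.gnsStarAlgHom b (ω.toPreGNS 1 : ω.GNS) := by
    simp only [ω.gnsStarAlgHom_apply_toPreGNS_one]
    exact UniformSpace.Completion.denseRange_coe.comp ω.toPreGNS.surjective.denseRange
      (UniformSpace.Completion.continuous_coe _)
  have hωξ : ∀ b, ω b = ⟪(ω.toPreGNS 1 : ω.GNS),
      ω.gnsStarAlgHom b (ω.toPreGNS 1 : ω.GNS)⟫_ℂ := fun b => by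
    rw [ω.gnsStarAlgHom_apply_toPreGNS_one, UniformSpace.Completion.inner_coe,
      PositiveLinearMap.preGNS_inner_def]
    simp
  exact ⟨hasUniqueExtensionProperty_of_isDetectableState hM_gen hξ hωξ hω,
    isIrreducibleRepresentation_of_isDetectableState hξ hωξ hω⟩
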